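/- Let $L$ be a first-order language and let $G$ be a group that is also an $L$-structure in which the group law is definable (so $G$ may carry structure beyond its group law). Suppose that $G$ is small, i.e. for every natural number $n$ the complete theory of $G$ has at most countably many complete $n$-types without parameters, and that $G$ is nilpotent. Then $G$ is the central product of a definable divisible subgroup and a definable subgroup of bounded exponent. That is, there are normal subgroups $D$ and $F$ of $G$, both definable (with parameters) in the $L$-structure $G$, such that: - for every $x\in D$ and every integer $n\ge 1$ there is $y\in D$ with $y^n=x$; - there is an integer $n\ge 1$ with $x^n=1$ for all $x\in F$; - $G=D\cdot F$ and $D\cap F\subseteq Z(G)$. -/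

import Mathlib

universe u v w

namespace SmallGroups

/-- A theory is small if, for every natural number `n`, it has at most countably many complete
`n`-types without parameters. -/
def IsSmallTheory {L : FirstOrder.Language.{u, v}} (T : L.Theory) : Prop :=
  ∀ n : ℕ, Countable (T.CompleteType (Fin n))

/-- A structure is small if its complete theory is small. -/
def IsSmallStructure (L : FirstOrder.Language.{u, v}) (M : Type w) [L.Structure M] : Prop :=
  IsSmallTheory (L.completeTheory M)

/-- The group law of `G` is definable (with parameters) in the `L`-structure `G`.  There may be
further structure on `G`, and `L` may contain a symbol for the multiplication or not. -/
def HasDefinableMul (L : FirstOrder.Language.{u, v}) (G : Type w) [L.Structure G] [Group G] : Prop :=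
  (Set.univ : Set G).Definable L {x : Fin 3 → G | x 0 * x 1 = x 2}

/-- A subgroup is definable (with parameters) if its underlying set is. -/
def IsDefinableSubgroup (L : FirstOrder.Language.{u, v}) {G : Type w} [L.Structure G] [Group G]
    (H : Subgroup G) : Prop :=
  (Set.univ : Set G).Definable₁ L (H : Set G)

/-- A (not necessarily abelian) subgroup is divisible if each of its elements has an `n`-th root
in it for every nonzero natural number `n`. -/
def IsDivisibleSubgroup {G : Type w} [Group G] (H : Subgroup G) : Prop :=
  ∀ n : ℕ, n ≠ 0 → ∀ x ∈ H, ∃ y ∈ H, y ^ n = x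

/-- A subgroup has bounded exponent if some fixed nonzero power kills all of its elements. -/
def HasBoundedExponent {G : Type w} [Group G] (H : Subgroup G) : Prop :=
  ∃ n : ℕ, n ≠ 0 ∧ ∀ x ∈ H, x ^ n = 1

/-- `G` is the central product of its normal subgroups `H` and `K`: it is the product of `H` and
`K`, and their intersection lies in the centre of `G`. -/
structure IsCentralProduct {G : Type w} [Group G] (H K : Subgroup G) : Prop where
  normal_left : H.Normal
  normal_right : K.Normal
  exists_mul_eq : ∀ g : G, ∃ h ∈ H, ∃ k ∈ K, h * k = g
  inf_le_center : H ⊓ K ≤ Subgroup.center G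

end SmallGroups

/-! ### Counting types over finitely many parameters -/

namespace SmallGroups

open FirstOrder FirstOrder.Language Set

/-! Smallness forces each abelian section Q of the upper central series to have a divisible subgroup
of n-th powers for some n ≥ 1 (`IsSmallStructure.isVirtuallyDivisible`). Otherwise either the chain
of p^m-th powers is strictly decreasing for some prime p, and p-adic digit sequences give continuum
many types, or Q ≠ Q^p for infinitely many primes p, and divisibility by them can be prescribed
independently, again giving continuum many types.

The rest is group theory. Induction through G/Z(G) writes G as DF with D divisible and F of bounded
exponent; the generators produced are controlled because commutators are bilinear between successive
lower central factors. In a nilpotent group a divisible subgroup commutes with every element of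
finite order. Hence for N killing F, (df)^N = d^N, so D is the set of N-th powers, the solutions of
x^N = 1 form a subgroup, and both are definable. -/

/-- A family of partial types over a finite set, indexed by infinite binary sequences, cannot be
pairwise inconsistent in a small structure. -/
theorem IsSmallStructure.exists_ne_forall_inter_nonempty {L : FirstOrder.Language.{u, v}} {M : Type w}
    [L.Structure M] [Nonempty M] (hM : IsSmallStructure L M) {A : Set M} (hA : A.Finite) {k : ℕ}
    (S : (ℕ → Bool) → ℕ → Set (Fin k → M)) (hS : ∀ ε i, A.Definable L (S ε i))
    (hne : ∀ ε m, ∃ v, ∀ i ≤ m, v ∈ S ε i) :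
    ∃ ε ε', ε ≠ ε' ∧ ∀ i j, (S ε i ∩ S ε' j).Nonempty := by
  classical
  have := hA.fintype
  simp only [definable_iff_exists_formula_sum] at hS
  choose φ hφ using hS
  -- Types are counted without parameters, so the finitely many elements of A become extra
  -- variables.
  let e : A ⊕ Fin k ≃ Fin (Fintype.card (A ⊕ Fin k)) := Fintype.equivFin _
  let w : (Fin k → M) → Fin (Fintype.card (A ⊕ Fin k)) → M :=
    fun v => Sum.elim (fun a : A => (a : M)) v ∘ e.symm
  let T := L.completeTheory M
  let ψ : (ℕ → Bool) → ℕ → L.Formula (Fin (Fintype.card (A ⊕ Fin k))) :=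
    fun ε i => (φ ε i).relabel e
  have hψ : ∀ ε i v, (ψ ε i).Realize (w v) ↔ v ∈ S ε i := by
    intro ε i v
    rw [hφ ε i, Formula.realize_relabel]
    have : w v ∘ e = Sum.elim (fun a : A => (a : M)) v := by
      ext x; simp [w]
    rw [this]
    rfl
  -- The formulas holding at every tuple that meets the first conditions. They increase with m and
  -- contain T from the start, so a model of the union yields a complete type containing the whole
  -- branch.
  let Γ : (ℕ → Bool) → ℕ → L[[Fin (Fintype.card (A ⊕ Fin k))]].Theory :=
    fun ε m => {σ | ∀ v, (∀ i ≤ m, v ∈ S ε i) → σ ∈ T.typeOf (w v)}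
  have hΓ : ∀ ε, FirstOrder.Language.Theory.IsSatisfiable (⋃ m, Γ ε m) := by
    intro ε
    rw [Theory.isSatisfiable_directed_union_iff]
    · intro m
      obtain ⟨v, hv⟩ := hne ε m
      exact (T.typeOf (w v)).isMaximal.1.mono fun σ hσ => hσ v hv
    · refine Monotone.directed_le fun m m' h σ hσ v hv => hσ v fun i hi => hv i (hi.trans h)
  have hp : ∀ ε, ∃ p : T.CompleteType (Fin (Fintype.card (A ⊕ Fin k))),
      ∀ m, Γ ε m ⊆ (p : L[[Fin (Fintype.card (A ⊕ Fin k))]].Theory) := by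
    intro ε
    obtain ⟨N⟩ := hΓ ε
    have hN : (⋃ m, Γ ε m) ⊆ L[[Fin (Fintype.card (A ⊕ Fin k))]].completeTheory N :=
      Theory.completeTheory.subset
    refine ⟨⟨_, ?_, completeTheory.isMaximal _ N⟩, fun m =>
      (Set.subset_iUnion (Γ ε) m).trans hN⟩
    have h0 : (L.lhomWithConstants _).onTheory T ⊆ Γ ε 0 :=
      fun σ hσ v _ => (T.typeOf (w v)).subset hσ
    exact (h0.trans (Set.subset_iUnion (Γ ε) 0)).trans hN
  choose p hp using hp
  have : Countable (T.CompleteType (Fin (Fintype.card (A ⊕ Fin k)))) := hM _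
  have hnc : ¬ Function.Injective p := fun h => by
    have h1 : Countable (ℕ → Bool) := h.countable
    obtain ⟨f, hf⟩ := exists_surjective_nat (ℕ → Bool)
    obtain ⟨n, hn⟩ := hf fun n => !(f n n)
    simpa using congrFun hn n
  simp only [Function.Injective, not_forall] at hnc
  obtain ⟨ε, ε', h, hεε'⟩ := hnc
  refine ⟨ε, ε', hεε', fun i j => ?_⟩
  by_contra hdisj
  rw [not_nonempty_iff_eq_empty] at hdisj
  have h1 : Formula.equivSentence (ψ ε' j) ∈ p ε' :=
    hp ε' j fun v hv => Theory.CompleteType.formula_mem_typeOf.2 ((hψ _ _ _).2 (hv j le_rfl))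
  have h2 : (Formula.equivSentence (ψ ε' j)).not ∈ p ε := by
    refine hp ε i fun v hv => ?_
    refine (Theory.CompleteType.not_mem_iff _ _).2 ?_
    intro h'
    have := (hψ _ _ _).1 (Theory.CompleteType.formula_mem_typeOf.1 h')
    exact (Set.ext_iff.1 hdisj v).1 ⟨hv i le_rfl, this⟩
  rw [h, Theory.CompleteType.not_mem_iff] at h2
  exact h2 h1

end SmallGroups

/-! ### Definability of group-theoretic sets -/

namespace SmallGroups

open FirstOrder FirstOrder.Language Set

section

variable {L : FirstOrder.Language.{u, v}} {G : Type w} [L.Structure G] {A : Set G} {α β : Type*}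

/-- A function from tuples to elements is definable over `A` if its graph is. -/
def DefinableMap (L : FirstOrder.Language.{u, v}) {G : Type w} [L.Structure G] (A : Set G)
    {α : Type*} (t : (α → G) → G) : Prop :=
  A.Definable L {x : α ⊕ Fin 1 → G | x (Sum.inr 0) = t (x ∘ Sum.inl)}

theorem definableMap_proj (a : α) : DefinableMap L A fun v : α → G => v a :=
  (Definable.diagonal L A).preimage_comp ![Sum.inr 0, Sum.inl a]

theorem DefinableMap.comp {t : (α → G) → G} (ht : DefinableMap L A t) (f : α → β) :
    DefinableMap L A fun v : β → G => t (v ∘ f) :=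
  Definable.preimage_comp (Sum.map f id) ht

theorem DefinableMap.subst {t : (α → G) → G} (ht : DefinableMap L A t)
    {S : Set (α ⊕ Fin 1 → G)} (hS : A.Definable L S) :
    A.Definable L {v | Sum.elim v (fun _ => t v) ∈ S} := by
  convert (Definable.inter ht hS).exists_of_finite using 1
  ext v
  constructor
  · exact fun h => ⟨fun _ => t v, rfl, h⟩
  · rintro ⟨u, hu, h⟩
    have : u = fun _ => t v := by
      ext i
      rw [Subsingleton.elim i 0]
      exact hu
    rwa [this] at h

theorem DefinableMap.definable_mem {t : (α → G) → G} (ht : DefinableMap L A t) {S : Set G}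
    (hS : A.Definable₁ L S) : A.Definable L {v | t v ∈ S} :=
  ht.subst (hS.preimage_comp fun _ => Sum.inr 0)

theorem DefinableMap.definable_eq {s t : (α → G) → G} (hs : DefinableMap L A s)
    (ht : DefinableMap L A t) : A.Definable L {v | s v = t v} :=
  hs.subst ht

theorem definable_exists {R : (α → G) → G → Prop}
    (hR : A.Definable L {w : α ⊕ Fin 1 → G | R (w ∘ Sum.inl) (w (Sum.inr 0))}) :
    A.Definable L {v | ∃ y, R v y} := by
  convert hR.exists_of_finite using 1
  ext v
  exact ⟨fun ⟨y, hy⟩ => ⟨fun _ => y, hy⟩, fun ⟨u, hu⟩ => ⟨u 0, hu⟩⟩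

theorem definable_forall {R : (α → G) → G → Prop}
    (hR : A.Definable L {w : α ⊕ Fin 1 → G | R (w ∘ Sum.inl) (w (Sum.inr 0))}) :
    A.Definable L {v | ∀ y, R v y} := by
  convert hR.forall_of_finite using 1
  ext v
  exact ⟨fun h u => h (u 0), fun h y => h fun _ => y⟩

variable [Group G] (hmul : A.Definable L {x : Fin 3 → G | x 0 * x 1 = x 2})

include hmul

theorem DefinableMap.mul {s t : (α → G) → G} (hs : DefinableMap L A s) (ht : DefinableMap L A t) :
    DefinableMap L A fun v => s v * t v := by
  have h1 : A.Definable L {w : ((α ⊕ Fin 1) ⊕ Fin 1) ⊕ Fin 1 → G |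
      w (Sum.inl (Sum.inr 0)) * w (Sum.inr 0) = w (Sum.inl (Sum.inl (Sum.inr 0)))} :=
    hmul.preimage_comp ![Sum.inl (Sum.inr 0), Sum.inr 0, Sum.inl (Sum.inl (Sum.inr 0))]
  have h2 := (hs.comp (Sum.inl : α → α ⊕ Fin 1)).subst
    (((ht.comp (Sum.inl : α → α ⊕ Fin 1)).comp
      (Sum.inl : α ⊕ Fin 1 → (α ⊕ Fin 1) ⊕ Fin 1)).subst h1)
  refine (congrArg (A.Definable L) (Set.ext fun v => ?_)).mp h2
  exact eq_comm

theorem DefinableMap.one : DefinableMap L A fun _ : α → G => 1 := by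
  have h := ((definableMap_proj (L := L) (A := A) (Sum.inr 0 : α ⊕ Fin 1)).mul hmul
    (definableMap_proj (Sum.inr 0))).definable_eq (definableMap_proj (Sum.inr 0))
  exact (congrArg (A.Definable L) (Set.ext fun v => mul_eq_left)).mp h

theorem DefinableMap.pow {t : (α → G) → G} (ht : DefinableMap L A t) (n : ℕ) :
    DefinableMap L A fun v => t v ^ n := by
  induction n with
  | zero => simpa using DefinableMap.one hmul
  | succ n ih => simpa only [pow_succ] using ih.mul hmul ht

theorem DefinableMap.inv {t : (α → G) → G} (ht : DefinableMap L A t) :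
    DefinableMap L A fun v => (t v)⁻¹ := by
  have h := ((definableMap_proj (L := L) (A := A) (Sum.inr 0 : α ⊕ Fin 1)).mul hmul
    (ht.comp Sum.inl)).definable_eq (DefinableMap.one hmul)
  exact (congrArg (A.Definable L) (Set.ext fun v => mul_eq_one_iff_eq_inv)).mp h

theorem definable_upperCentralSeries (n : ℕ) :
    A.Definable₁ L (Subgroup.upperCentralSeries G n : Set G) := by
  induction n with
  | zero =>
    exact (definableMap_proj (0 : Fin 1)).definable_eq (DefinableMap.one hmul)
  | succ n ih =>
    refine definable_forall (R := fun v y =>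
      v 0 * y * (v 0)⁻¹ * y⁻¹ ∈ (Subgroup.upperCentralSeries G n : Set G)) ?_
    refine DefinableMap.definable_mem ?_ ih
    have hx := definableMap_proj (L := L) (A := A) (Sum.inl 0 : Fin 1 ⊕ Fin 1)
    have hy := definableMap_proj (L := L) (A := A) (Sum.inr 0 : Fin 1 ⊕ Fin 1)
    exact ((hx.mul hmul hy).mul hmul (hx.inv hmul)).mul hmul (hy.inv hmul)

/-- The products of a `k`-th power of an element of `C` and of an element of `N` form a definable
set. -/
theorem definable_pow_mul {C N : Subgroup G} (hC : A.Definable₁ L (C : Set G))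
    (hN : A.Definable₁ L (N : Set G)) (k : ℕ) :
    A.Definable₁ L {x | ∃ y, y ∈ C ∧ (y ^ k)⁻¹ * x ∈ N} := by
  refine definable_exists (R := fun v y => y ∈ C ∧ (y ^ k)⁻¹ * v 0 ∈ N) ?_
  have hx := definableMap_proj (L := L) (A := A) (Sum.inl 0 : Fin 1 ⊕ Fin 1)
  have hy := definableMap_proj (L := L) (A := A) (Sum.inr 0 : Fin 1 ⊕ Fin 1)
  exact (hy.definable_mem hC).inter
    ((((hy.pow hmul k).inv hmul).mul hmul hx).definable_mem hN)

end

end SmallGroups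

/-! ### Abelian sections of small groups -/

namespace SmallGroups

section

variable {Q : Type*} [CommGroup Q]

/-- The subgroup of `k`-th powers of an abelian group. -/
def powers (Q : Type*) [CommGroup Q] (k : ℕ) : Subgroup Q := (powMonoidHom k : Q →* Q).range

theorem mem_powers {k : ℕ} {x : Q} : x ∈ powers Q k ↔ ∃ y, y ^ k = x := Iff.rfl

theorem pow_mem_powers (x : Q) (k : ℕ) : x ^ k ∈ powers Q k := ⟨x, rfl⟩

theorem pow_mem_powers_of_dvd (x : Q) {k l : ℕ} (h : k ∣ l) : x ^ l ∈ powers Q k := by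
  obtain ⟨m, rfl⟩ := h
  exact ⟨x ^ m, by simp [← pow_mul, mul_comm]⟩

theorem pow_mem_powers_iff {x : Q} {k u : ℕ} (h : u ≡ 1 [MOD k]) :
    x ^ u ∈ powers Q k ↔ x ∈ powers Q k := by
  refine ⟨fun hx => ?_, fun hx => pow_mem hx u⟩
  have h1 : (k : ℤ) ∣ 1 - u := (Nat.modEq_iff_dvd.1 h)
  obtain ⟨m, hm⟩ := h1
  have h2 : x = x ^ u * (x ^ m) ^ k := by
    rw [← zpow_natCast, ← zpow_natCast, ← zpow_mul, ← zpow_add, mul_comm m, ← hm]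
    simp
  rw [h2]
  exact mul_mem hx (pow_mem_powers _ _)

/-- Divisibility by finitely many distinct primes can be prescribed independently. -/
theorem exists_mem_powers_iff {p : ℕ → ℕ} (hp : ∀ j, (p j).Prime) (hinj : Function.Injective p)
    (hne : ∀ j, powers Q (p j) ≠ ⊤) (ε : ℕ → Bool) (m : ℕ) :
    ∃ x : Q, ∀ j < m, (x ∈ powers Q (p j) ↔ ε j = true) := by
  induction m with
  | zero => exact ⟨1, by simp⟩
  | succ m ih =>
    obtain ⟨x, hx⟩ := ih
    obtain ⟨a, ha⟩ : ∃ a : Q, a ∉ powers Q (p m) := by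
      by_contra! h
      exact hne m (eq_top_iff.2 fun a _ => h a)
    have hcop : Nat.Coprime (∏ j ∈ Finset.range m, p j) (p m) := by
      refine Nat.Coprime.prod_left fun j hj => ?_
      exact (Nat.coprime_primes (hp j) (hp m)).2 fun h =>
        (Finset.mem_range.1 hj).ne (hinj h)
    -- Raising to the power s keeps the behaviour at the earlier primes and makes the element a `p
    -- m`-th power; t does the reverse.
    obtain ⟨s, hs1, hs2⟩ := Nat.chineseRemainder hcop 1 0
    obtain ⟨t, ht1, ht2⟩ := Nat.chineseRemainder hcop 0 1
    refine ⟨x ^ s * (if ε m then 1 else a) ^ t, fun j hj => ?_⟩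
    rcases Nat.lt_succ_iff_lt_or_eq.1 hj with hj | rfl
    · have hd : p j ∣ ∏ j ∈ Finset.range m, p j :=
        Finset.dvd_prod_of_mem _ (Finset.mem_range.2 hj)
      rw [Subgroup.mul_mem_cancel_right _
        (pow_mem_powers_of_dvd _ (hd.trans ((Nat.modEq_zero_iff_dvd).1 ht1))),
        pow_mem_powers_iff (hs1.of_dvd hd), hx j hj]
    · rw [Subgroup.mul_mem_cancel_left _
        (pow_mem_powers_of_dvd _ ((Nat.modEq_zero_iff_dvd).1 hs2)), pow_mem_powers_iff ht2]
      cases h : ε j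
      · simpa using ha
      · simp

/-- An abelian group is virtually divisible if the subgroup of `n`-th powers is divisible for some
positive `n`. -/
def IsVirtuallyDivisible (Q : Type*) [CommGroup Q] : Prop :=
  ∃ n : ℕ, n ≠ 0 ∧ ∀ k : ℕ, k ≠ 0 → ∀ q : Q, ∃ r : Q, r ^ (n * k) = q ^ n

theorem isVirtuallyDivisible_of_prime {n : ℕ} (hn : n ≠ 0)
    (h : ∀ p : ℕ, p.Prime → ∀ q : Q, ∃ r : Q, r ^ (n * p) = q ^ n) : IsVirtuallyDivisible Q := by
  refine ⟨n, hn, fun k => ?_⟩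
  induction k using Nat.recOnMul with
  | zero => exact fun h => absurd rfl h
  | one => exact fun _ q => ⟨q, by simp⟩
  | prime p hp => exact fun _ => h p hp
  | mul a b iha ihb =>
    intro hab q
    obtain ⟨r, hr⟩ := iha (left_ne_zero_of_mul hab) q
    obtain ⟨s, hs⟩ := ihb (right_ne_zero_of_mul hab) r
    refine ⟨s, ?_⟩
    rw [mul_comm a b, ← mul_assoc, pow_mul, hs, ← pow_mul, hr]

theorem isVirtuallyDivisible_of_finite
    (h1 : ∀ p : ℕ, p.Prime → ∃ m : ℕ, ∀ q : Q, q ^ p ^ m ∈ powers Q (p ^ (m + 1)))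
    (h2 : {p : ℕ | p.Prime ∧ powers Q p ≠ ⊤}.Finite) : IsVirtuallyDivisible Q := by
  have h1' : ∀ p : ℕ, ∃ m : ℕ, p.Prime → ∀ q : Q, q ^ p ^ m ∈ powers Q (p ^ (m + 1)) := fun p => by
    by_cases hp : p.Prime
    · obtain ⟨m, hm⟩ := h1 p hp
      exact ⟨m, fun _ => hm⟩
    · exact ⟨0, fun h => absurd h hp⟩
  choose m hm using h1'
  -- Only the finitely many primes p with Q ≠ Q^p contribute, each with the exponent where its chain
  -- of powers has stabilised.
  refine isVirtuallyDivisible_of_prime (n := ∏ p ∈ h2.toFinset, p ^ m p)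
    (Finset.prod_ne_zero_iff.2 fun p hp => ?_) fun p hp q => ?_
  · exact pow_ne_zero _ ((Set.Finite.mem_toFinset h2).1 hp).1.ne_zero
  by_cases hpt : powers Q p = ⊤
  · obtain ⟨r, hr⟩ := mem_powers.1 (hpt ▸ Subgroup.mem_top q)
    exact ⟨r, by rw [mul_comm, pow_mul, hr]⟩
  · obtain ⟨c, hc⟩ := Finset.dvd_prod_of_mem (fun p => p ^ m p)
      ((Set.Finite.mem_toFinset h2).2 ⟨hp, hpt⟩)
    obtain ⟨r, hr⟩ := mem_powers.1 (hm p hp q)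
    refine ⟨r, ?_⟩
    rw [hc, pow_mul q, ← hr, ← pow_mul]
    congr 1
    ring

end

theorem exists_least_ne {ε ε' : ℕ → Bool} (h : ε ≠ ε') : ∃ j, ε j ≠ ε' j ∧ ∀ i < j, ε i = ε' i := by
  classical
  have h' : ∃ j, ε j ≠ ε' j := by
    by_contra! hc
    exact h (funext hc)
  exact ⟨Nat.find h', Nat.find_spec h', fun i hi => not_not.1 (Nat.find_min h' hi)⟩

open FirstOrder FirstOrder.Language Set

variable {L : FirstOrder.Language.{u, v}} {G : Type w} [L.Structure G] [Group G] {A : Set G}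
  {Q : Type*} [CommGroup Q]

/-- An abelian section of a small group whose subgroups of powers are definable over a fixed finite
set is virtually divisible. -/
theorem IsSmallStructure.isVirtuallyDivisible (hG : IsSmallStructure L G) (hA : A.Finite)
    (hmul : A.Definable L {x : Fin 3 → G | x 0 * x 1 = x 2}) {C : Subgroup G} (f : C →* Q)
    (hf : Function.Surjective f)
    (hdef : ∀ k, A.Definable₁ L (((powers Q k).comap f).map C.subtype : Set G)) :
    IsVirtuallyDivisible Q := by
  have hmem : ∀ (x : C) k, (x : G) ∈ (((powers Q k).comap f).map C.subtype : Set G) ↔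
      f x ∈ powers Q k := by
    intro x k
    simp
  have hx0 := definableMap_proj (L := L) (A := A) (0 : Fin 2)
  have hx1 := definableMap_proj (L := L) (A := A) (1 : Fin 2)
  have hmemC : ∀ x, x ∈ (((powers Q 1).comap f).map C.subtype : Set G) ↔ x ∈ C := by
    intro x
    simp [mem_powers]
  apply isVirtuallyDivisible_of_finite
  · intro p hp
    by_contra! hc
    -- s ε i truncates the p-adic integer with digits ε. The type of (x, y) says that y approximates
    -- x to the power minus that integer, and that x witnesses strictness of the chain at every
    -- level.
    let s : (ℕ → Bool) → ℕ → ℕ := fun ε i => ∑ j ∈ Finset.range i, if ε j then p ^ j else 0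
    let S : (ℕ → Bool) → ℕ → Set (Fin 2 → G) := fun ε i =>
      {v | v 0 ∈ (((powers Q 1).comap f).map C.subtype : Set G)} ∩
        {v | v 1 ∈ (((powers Q 1).comap f).map C.subtype : Set G)} ∩
        ({v | v 0 ^ p ^ i ∈ (((powers Q (p ^ (i + 1))).comap f).map C.subtype : Set G)}ᶜ ∩
        {v | v 1 * v 0 ^ s ε i ∈ (((powers Q (p ^ i)).comap f).map C.subtype : Set G)})
    have hS : ∀ ε i, A.Definable L (S ε i) := fun ε i =>
      ((hx0.definable_mem (hdef _)).inter (hx1.definable_mem (hdef _))).inter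
        (((hx0.pow hmul _).definable_mem (hdef _)).compl.inter
          ((hx1.mul hmul (hx0.pow hmul _)).definable_mem (hdef _)))
    have hmemS : ∀ ε i (x y : C), ![(x : G), (y : G)] ∈ S ε i ↔
        f x ^ p ^ i ∉ powers Q (p ^ (i + 1)) ∧ f y * f x ^ s ε i ∈ powers Q (p ^ i) := by
      intro ε i x y
      simp only [S, mem_inter_iff, mem_compl_iff, mem_ofPred_eq, Matrix.cons_val_zero,
        Matrix.cons_val_one, hmemC, SetLike.coe_mem, true_and]
      rw [← Subgroup.coe_pow, ← Subgroup.coe_pow, ← Subgroup.coe_mul, hmem, hmem]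
      simp only [map_pow, map_mul]
    obtain ⟨ε, ε', hne, h⟩ := hG.exists_ne_forall_inter_nonempty hA S hS fun ε m => by
      obtain ⟨q, hq⟩ := hc m
      obtain ⟨x, rfl⟩ := hf q
      refine ⟨![(x : G), ((x ^ s ε m)⁻¹ : C)], fun i hi => (hmemS _ _ _ _).2 ⟨fun h => hq ?_, ?_⟩⟩
      · obtain ⟨r, hr⟩ := mem_powers.1 h
        refine mem_powers.2 ⟨r, ?_⟩
        obtain ⟨d, rfl⟩ := Nat.exists_eq_add_of_le hi
        rw [pow_add p i d, pow_mul, ← hr, ← pow_mul]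
        congr 1
        ring
      · have hsplit : s ε m = s ε i + ∑ j ∈ Finset.Ico i m, if ε j then p ^ j else 0 :=
          (Finset.sum_range_add_sum_Ico _ hi).symm
        rw [map_inv, map_pow, hsplit, pow_add, mul_inv_rev, inv_mul_cancel_right]
        refine inv_mem (pow_mem_powers_of_dvd _ (Finset.dvd_sum fun j hj => ?_))
        split_ifs
        · exact pow_dvd_pow p (Finset.mem_Ico.1 hj).1
        · exact dvd_zero _
    obtain ⟨j, hj, hlt⟩ := exists_least_ne hne
    have hs : s ε j = s ε' j := Finset.sum_congr rfl fun i hi => by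
      rw [hlt i (Finset.mem_range.1 hi)]
    -- At level j + 1 the truncations differ by exactly p^j, so dividing the two conditions makes
    -- x^(p^j) a p^(j+1)-th power. A further p-th power contradicts strictness at level j + 1.
    obtain ⟨v, hv⟩ := h (j + 1) (j + 1)
    obtain ⟨x, y, rfl⟩ : ∃ x y : C, v = ![(x : G), (y : G)] := by
      obtain ⟨⟨h0, h1⟩, -⟩ := hv.1
      refine ⟨⟨v 0, (hmemC _).1 h0⟩, ⟨v 1, (hmemC _).1 h1⟩, ?_⟩
      ext i
      fin_cases i <;> rfl
    rw [mem_inter_iff, hmemS, hmemS] at hv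
    obtain ⟨⟨hx, h1⟩, -, h2⟩ := hv
    suffices hxj : f x ^ p ^ j ∈ powers Q (p ^ (j + 1)) by
      obtain ⟨r, hr⟩ := mem_powers.1 hxj
      exact hx (mem_powers.2 ⟨r, by rw [pow_succ p (j + 1), pow_mul, hr, ← pow_mul, ← pow_succ]⟩)
    simp only [s, Finset.sum_range_succ] at h1 h2
    change f y * f x ^ (s ε j + _) ∈ _ at h1
    change f y * f x ^ (s ε' j + _) ∈ _ at h2
    rw [← hs] at h2
    cases hε : ε j <;> cases hε' : ε' j
    · exact absurd (hε.trans hε'.symm) hj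
    · rw [hε] at h1
      rw [hε', if_pos rfl, pow_add (f x), ← mul_assoc] at h2
      exact (Subgroup.mul_mem_cancel_left _ (by simpa using h1)).1 h2
    · rw [hε, if_pos rfl, pow_add (f x), ← mul_assoc] at h1
      rw [hε'] at h2
      exact (Subgroup.mul_mem_cancel_left _ (by simpa using h2)).1 h1
    · exact absurd (hε.trans hε'.symm) hj
  · by_contra hinf
    have hinf : {p : ℕ | p.Prime ∧ powers Q p ≠ ⊤}.Infinite := hinf
    let p : ℕ → ℕ := fun i => hinf.natEmbedding _ i
    have hp : ∀ i, (p i).Prime ∧ powers Q (p i) ≠ ⊤ := fun i => (hinf.natEmbedding _ i).2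
    have hinj : Function.Injective p := fun i j hij =>
      (hinf.natEmbedding _).injective (Subtype.ext hij)
    let S : (ℕ → Bool) → ℕ → Set (Fin 1 → G) := fun ε i =>
      if ε i then {v | v 0 ∈ (((powers Q (p i)).comap f).map C.subtype : Set G)}
      else {v | v 0 ∈ (((powers Q (p i)).comap f).map C.subtype : Set G)}ᶜ
    have hmemS : ∀ ε i v, v ∈ S ε i ↔
        (v 0 ∈ (((powers Q (p i)).comap f).map C.subtype : Set G) ↔ ε i = true) := by
      intro ε i v
      by_cases h : ε i = true <;> simp only [S, h] <;> simp
    obtain ⟨ε, ε', hne, h⟩ := hG.exists_ne_forall_inter_nonempty hA S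
      (fun ε i => by
        have h := (definableMap_proj (L := L) (A := A) (0 : Fin 1)).definable_mem (hdef (p i))
        dsimp only [S]
        split_ifs
        · exact h
        · exact h.compl)
      fun ε m => by
        obtain ⟨q, hq⟩ := exists_mem_powers_iff (fun i => (hp i).1) hinj (fun i => (hp i).2) ε (m + 1)
        obtain ⟨x, rfl⟩ := hf q
        exact ⟨fun _ => x, fun i hi => (hmemS _ _ _).2
          ((hmem x _).trans (hq i (Nat.lt_succ_of_le hi)))⟩
    obtain ⟨j, hj, -⟩ := exists_least_ne hne
    obtain ⟨v, h1, h2⟩ := h j j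
    exact hj (Bool.eq_iff_iff.2 (((hmemS _ _ _).1 h1).symm.trans ((hmemS _ _ _).1 h2)))

end SmallGroups

/-! ### Commutators and generation in nilpotent groups -/

namespace SmallGroups

section

open Subgroup
open scoped commutatorElement

variable {G : Type*} [Group G]

theorem pow_mul_of_mul_eq {a b z : G} (hz : z ∈ center G) (h : a * b = z * (b * a)) (k : ℕ) :
    a ^ k * b = z ^ k * (b * a ^ k) := by
  have hz' : ∀ g, g * z = z * g := mem_center_iff.1 hz
  induction k with
  | zero => simp
  | succ k ih =>
    have hzk : a * z ^ k = z ^ k * a := (Commute.pow_right (hz' a) k)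
    calc a ^ (k + 1) * b = a * (a ^ k * b) := by rw [pow_succ', mul_assoc]
      _ = z ^ k * (a * b) * a ^ k := by rw [ih, ← mul_assoc, hzk]; simp only [mul_assoc]
      _ = z ^ (k + 1) * (b * a ^ (k + 1)) := by
        rw [h, pow_succ z, pow_succ' a]; simp only [mul_assoc]

theorem mul_pow_of_mul_eq {a b z : G} (hz : z ∈ center G) (h : a * b = z * (b * a)) (k : ℕ) :
    a * b ^ k = z ^ k * (b ^ k * a) := by
  have hz' : ∀ g, g * z = z * g := mem_center_iff.1 hz
  induction k with
  | zero => simp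
  | succ k ih =>
    have hzk : b ^ k * z = z * b ^ k := hz' _
    calc a * b ^ (k + 1) = z ^ k * b ^ k * (a * b) := by
          rw [pow_succ, ← mul_assoc, ih]; simp only [mul_assoc]
      _ = z ^ k * (b ^ k * z) * (b * a) := by rw [h]; simp only [mul_assoc]
      _ = z ^ (k + 1) * (b ^ (k + 1) * a) := by
        rw [hzk, pow_succ z, pow_succ b]; simp only [mul_assoc]

theorem commutatorElement_pow_left {a b : G} (h : ⁅a, b⁆ ∈ center G) (k : ℕ) :
    ⁅a ^ k, b⁆ = ⁅a, b⁆ ^ k := by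
  have h1 := pow_mul_of_mul_eq (a := a) (b := b) h (by simp [commutatorElement_def, mul_assoc]) k
  rw [commutatorElement_def, h1]
  group

/-- In a nilpotent group, elements of bounded order commute with powers of high enough exponent. -/
theorem exists_commute_pow_of_isNilpotent (G : Type*) [Group G] [Group.IsNilpotent G] {n : ℕ}
    (hn : n ≠ 0) : ∃ N : ℕ, N ≠ 0 ∧ ∀ a b : G, b ^ n = 1 → Commute (a ^ N) b := by
  refine Group.nilpotent_center_quotient_ind (P := fun G _ _ =>
    ∃ N : ℕ, N ≠ 0 ∧ ∀ a b : G, b ^ n = 1 → Commute (a ^ N) b) G ?_ ?_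
  · intro G _ _
    exact ⟨1, one_ne_zero, fun a b _ => Subsingleton.elim _ _⟩
  · intro G _ _ ih
    obtain ⟨N, hN, h⟩ := ih
    refine ⟨N * n, mul_ne_zero hN hn, fun a b hb => ?_⟩
    have hz : ⁅a ^ N, b⁆ ∈ center G := by
      rw [← QuotientGroup.eq_one_iff]
      have := h (a : G ⧸ center G) b (by rw [← QuotientGroup.mk_pow, hb, QuotientGroup.mk_one])
      exact commutatorElement_eq_one_iff_commute.2 this
    -- With z = ⁅a^N, b⁆ central, z^n = ⁅a^N, b^n⁆ = 1, hence ⁅a^(N n), b⁆ = z^n = 1.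
    have hab : a ^ N * b = ⁅a ^ N, b⁆ * (b * a ^ N) := by simp [commutatorElement_def, mul_assoc]
    have h1 := mul_pow_of_mul_eq hz hab n
    rw [hb, mul_one, one_mul, right_eq_mul] at h1
    have h2 := pow_mul_of_mul_eq hz hab n
    rwa [h1, one_mul, ← pow_mul] at h2

/-- The lower central series of a group. -/
abbrev lcs (G : Type*) [Group G] (i : ℕ) : Subgroup G := (⊤ : Subgroup G).lowerCentralSeries i

theorem mk_mem_center_of_mem_lcs {i : ℕ} {x : G} (hx : x ∈ lcs G i) :
    (x : G ⧸ lcs G (i + 1)) ∈ center (G ⧸ lcs G (i + 1)) := by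
  rw [mem_center_iff]
  intro g
  induction g using QuotientGroup.induction_on with
  | H g =>
    rw [← QuotientGroup.mk_mul, ← QuotientGroup.mk_mul, QuotientGroup.eq]
    have : (g * x)⁻¹ * (x * g) = ⁅x⁻¹, g⁻¹⁆ := by simp [commutatorElement_def, mul_assoc]
    rw [this]
    exact commutator_mem_commutator (inv_mem hx) (mem_top _)

theorem mk_commutatorElement_pow {i : ℕ} {x : G} (hx : x ∈ lcs G i) (g : G) (k : ℕ) :
    ((⁅x ^ k, g⁆ : G) : G ⧸ lcs G (i + 2)) = ((⁅x, g⁆ : G) : G ⧸ lcs G (i + 2)) ^ k := by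
  have h := mk_mem_center_of_mem_lcs
    (show ⁅x, g⁆ ∈ lcs G (i + 1) from commutator_mem_commutator hx (mem_top g))
  exact commutatorElement_pow_left (a := (x : G ⧸ lcs G (i + 2))) (b := g) h k

theorem lcs_succ_induction {i : ℕ} {P : G → Prop} {x : G} (hx : x ∈ lcs G (i + 1))
    (comm : ∀ x ∈ lcs G i, ∀ g, P ⁅x, g⁆) (one : P 1)
    (mul : ∀ x ∈ lcs G (i + 1), ∀ y ∈ lcs G (i + 1), P x → P y → P (x * y))
    (inv : ∀ x ∈ lcs G (i + 1), P x → P x⁻¹) : P x := by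
  refine closure_induction (p := fun x _ => P x) ?_ one (fun x y hx hy => mul x hx y hy)
    (fun x hx => inv x hx) hx
  rintro _ ⟨y, hy, g, -, rfl⟩
  exact comm y hy g

section

variable {S : Set G} (hS : closure S = ⊤)

include hS

/-- The factors of the lower central series are abelian, so generators suffice. For a commutator,
⁅y, g⁆^m ≡ ⁅y^m, g⁆ modulo `lcs G (i + 2)`, and y^m already lies one step deeper. -/
theorem pow_mem_lcs_succ {m : ℕ} (hm : ∀ s ∈ S, s ^ m = 1) (i : ℕ) :
    ∀ x ∈ lcs G i, x ^ m ∈ lcs G (i + 1) := by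
  have hmul : ∀ i, ∀ x ∈ lcs G i, ∀ y ∈ lcs G i, x ^ m ∈ lcs G (i + 1) → y ^ m ∈ lcs G (i + 1) →
      (x * y) ^ m ∈ lcs G (i + 1) := by
    intro i x hx y _ h1 h2
    rw [← QuotientGroup.eq_one_iff, QuotientGroup.mk_pow] at h1 h2 ⊢
    have hc : Commute (x : G ⧸ lcs G (i + 1)) y :=
      (mem_center_iff.1 (mk_mem_center_of_mem_lcs hx) _).symm
    rw [QuotientGroup.mk_mul, hc.mul_pow, h1, h2, one_mul]
  have hinv : ∀ i, ∀ x ∈ lcs G i, x ^ m ∈ lcs G (i + 1) → x⁻¹ ^ m ∈ lcs G (i + 1) := by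
    intro i x _ h
    rw [inv_pow]
    exact inv_mem h
  induction i with
  | zero =>
    intro x _
    have hx : x ∈ closure S := hS ▸ mem_top x
    refine closure_induction (p := fun x _ => x ^ m ∈ lcs G 1) (fun s hs => ?_) ?_
      (fun x y _ _ => hmul 0 x (mem_top x) y (mem_top y)) (fun x _ => hinv 0 x (mem_top x)) hx
    · rw [hm s hs]
      exact one_mem _
    · rw [one_pow]
      exact one_mem _
  | succ i ih =>
    intro x hx
    refine lcs_succ_induction (P := fun x => x ^ m ∈ lcs G (i + 2)) hx (fun y hy g => ?_) (by rw [one_pow]; exact one_mem _)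
      (hmul (i + 1)) (hinv (i + 1))
    rw [← QuotientGroup.eq_one_iff, QuotientGroup.mk_pow, ← mk_commutatorElement_pow hy,
      QuotientGroup.eq_one_iff]
    exact commutator_mem_commutator (ih y hy) (mem_top g)

/-- Roots pass down the series: if y ≡ z^k modulo `lcs G (i + 1)`, the error is central modulo `lcs
G (i + 2)`, so ⁅y, g⁆ ≡ ⁅z^k, g⁆ ≡ ⁅z, g⁆^k there. -/
theorem exists_pow_mul_eq_of_mem_lcs {k : ℕ} (hk : ∀ s ∈ S, ∃ t, t ^ k = s) (i : ℕ) :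
    ∀ x ∈ lcs G i, ∃ y ∈ lcs G i, (y : G ⧸ lcs G (i + 1)) ^ k = x := by
  have hmul : ∀ i, ∀ x ∈ lcs G i, ∀ y ∈ lcs G i,
      (∃ z ∈ lcs G i, (z : G ⧸ lcs G (i + 1)) ^ k = x) →
      (∃ z ∈ lcs G i, (z : G ⧸ lcs G (i + 1)) ^ k = y) →
      ∃ z ∈ lcs G i, (z : G ⧸ lcs G (i + 1)) ^ k = (x * y : G) := by
    rintro i x hx y hy ⟨z, hz, h1⟩ ⟨w, hw, h2⟩
    refine ⟨z * w, mul_mem hz hw, ?_⟩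
    have hc : Commute (z : G ⧸ lcs G (i + 1)) w :=
      (mem_center_iff.1 (mk_mem_center_of_mem_lcs hz) _).symm
    rw [QuotientGroup.mk_mul, hc.mul_pow, h1, h2, QuotientGroup.mk_mul]
  have hinv : ∀ i, ∀ x ∈ lcs G i,
      (∃ z ∈ lcs G i, (z : G ⧸ lcs G (i + 1)) ^ k = x) →
      ∃ z ∈ lcs G i, (z : G ⧸ lcs G (i + 1)) ^ k = (x⁻¹ : G) := by
    rintro i x hx ⟨z, hz, h1⟩
    exact ⟨z⁻¹, inv_mem hz, by rw [QuotientGroup.mk_inv, inv_pow, h1, QuotientGroup.mk_inv]⟩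
  have hone : ∀ i, ∃ z ∈ lcs G i, (z : G ⧸ lcs G (i + 1)) ^ k = (1 : G) :=
    fun i => ⟨1, one_mem _, one_pow k⟩
  induction i with
  | zero =>
    intro x _
    have hx : x ∈ closure S := hS ▸ mem_top x
    refine closure_induction
      (p := fun x _ => ∃ z ∈ lcs G 0, (z : G ⧸ lcs G 1) ^ k = (x : G)) (fun s hs => ?_) (hone 0)
      (fun x y _ _ => hmul 0 x (mem_top x) y (mem_top y)) (fun x _ => hinv 0 x (mem_top x)) hx
    obtain ⟨t, rfl⟩ := hk s hs
    exact ⟨t, mem_top t, rfl⟩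
  | succ i ih =>
    intro x hx
    refine lcs_succ_induction
      (P := fun x => ∃ z ∈ lcs G (i + 1), (z : G ⧸ lcs G (i + 2)) ^ k = (x : G))
      hx (fun y hy g => ?_) (hone (i + 1)) (hmul (i + 1)) (hinv (i + 1))
    obtain ⟨z, hz, hzy⟩ := ih y hy
    have hzg : ⁅z, g⁆ ∈ lcs G (i + 1) := commutator_mem_commutator hz (mem_top g)
    refine ⟨⁅z, g⁆, hzg, ?_⟩
    rw [← mk_commutatorElement_pow hz]
    rw [← QuotientGroup.mk_pow, QuotientGroup.eq] at hzy
    have hc := mk_mem_center_of_mem_lcs hzy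
    have hy' : (y : G ⧸ lcs G (i + 2)) = (z ^ k : G) * ((z ^ k)⁻¹ * y : G) := by
      rw [← QuotientGroup.mk_mul, mul_inv_cancel_left]
    change ⁅((z ^ k : G) : G ⧸ lcs G (i + 2)), (g : G ⧸ lcs G (i + 2))⁆ =
      ⁅(y : G ⧸ lcs G (i + 2)), (g : G ⧸ lcs G (i + 2))⁆
    rw [hy', commutatorElement_def, commutatorElement_def]
    generalize (((z ^ k)⁻¹ * y : G) : G ⧸ lcs G (i + 2)) = c at hc
    have hcg := mem_center_iff.1 hc g
    rw [mul_inv_rev, mul_assoc _ c, ← hcg]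
    simp only [mul_assoc, mul_inv_cancel_left]

end

/-- A nilpotent subgroup generated by elements of bounded order has bounded exponent. -/
theorem hasBoundedExponent_closure [Group.IsNilpotent G] {S : Set G} {m : ℕ} (hm0 : m ≠ 0)
    (hm : ∀ s ∈ S, s ^ m = 1) : HasBoundedExponent (closure S) := by
  obtain ⟨c, hc⟩ := Subgroup.nilpotent_iff_lowerCentralSeries.1
    (inferInstance : Group.IsNilpotent (closure S))
  have h : ∀ i, ∀ x : closure S, x ^ m ^ i ∈ lcs (closure S) i := by
    intro i x
    induction i with
    | zero => exact mem_top _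
    | succ i ih =>
      rw [pow_succ, pow_mul]
      exact pow_mem_lcs_succ (closure_closure_coe_preimage (k := S))
        (fun s hs => Subtype.ext (hm s hs)) i _ ih
  refine ⟨m ^ c, pow_ne_zero _ hm0, fun x hx => ?_⟩
  have := h c ⟨x, hx⟩
  rw [lcs, hc, mem_bot] at this
  exact congrArg Subtype.val this

/-- A nilpotent subgroup is divisible if it is generated by elements with roots in it. -/
theorem isDivisibleSubgroup_closure [Group.IsNilpotent G] {S : Set G}
    (h : ∀ k ≠ 0, ∀ s ∈ S, ∃ t ∈ closure S, t ^ k = s) : IsDivisibleSubgroup (closure S) := by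
  intro k hk x hx
  obtain ⟨c, hc⟩ := Subgroup.nilpotent_iff_lowerCentralSeries.1
    (inferInstance : Group.IsNilpotent (closure S))
  -- Successive approximation: the error of y is a k-th power w^k modulo the next term, where w is
  -- central, so y * w is a better root.
  have hroot : ∀ i, ∃ y : closure S, (y ^ k)⁻¹ * ⟨x, hx⟩ ∈ lcs (closure S) i := by
    intro i
    induction i with
    | zero => exact ⟨1, mem_top _⟩
    | succ i ih =>
      obtain ⟨y, hy⟩ := ih
      obtain ⟨w, hw, hwy⟩ := exists_pow_mul_eq_of_mem_lcs (closure_closure_coe_preimage (k := S))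
        (k := k) (fun s hs => by
          obtain ⟨t, ht, hts⟩ := h k hk s hs
          exact ⟨⟨t, ht⟩, Subtype.ext hts⟩) i _ hy
      refine ⟨y * w, ?_⟩
      rw [← QuotientGroup.eq]
      have hcomm : Commute (y : closure S ⧸ lcs (closure S) (i + 1)) w :=
        mem_center_iff.1 (mk_mem_center_of_mem_lcs hw) _
      rw [QuotientGroup.mk_pow, QuotientGroup.mk_mul, hcomm.mul_pow, hwy, QuotientGroup.mk_mul,
        QuotientGroup.mk_inv, QuotientGroup.mk_pow, mul_inv_cancel_left]
  obtain ⟨y, hy⟩ := hroot c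
  rw [lcs, hc, mem_bot, inv_mul_eq_one] at hy
  exact ⟨y, y.2, congrArg Subtype.val hy⟩

end

end SmallGroups

/-! ### Induction on the nilpotency class -/

namespace SmallGroups

section

open Subgroup
open scoped commutatorElement

variable {G : Type*} [Group G]

/-- The section `Z_{i+1} / Z_i` of the upper central series is virtually divisible. -/
def IsVirtuallyDivisibleSection (G : Type*) [Group G] (i : ℕ) : Prop :=
  ∃ n : ℕ, n ≠ 0 ∧ ∀ k : ℕ, k ≠ 0 → ∀ x ∈ Subgroup.upperCentralSeries G (i + 1),
    ∃ y ∈ Subgroup.upperCentralSeries G (i + 1), (y ^ (n * k))⁻¹ * x ^ n ∈ Subgroup.upperCentralSeries G i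

theorem IsVirtuallyDivisibleSection.quotient_center {i : ℕ}
    (h : IsVirtuallyDivisibleSection G (i + 1)) : IsVirtuallyDivisibleSection (G ⧸ center G) i := by
  have hmem : ∀ j (x : G), (x : G ⧸ center G) ∈ Subgroup.upperCentralSeries (G ⧸ center G) j ↔
      x ∈ Subgroup.upperCentralSeries G (j + 1) := by
    intro j x
    rw [← Nat.succ_eq_add_one, ← Subgroup.comap_upperCentralSeries_quotient_center]
    rfl
  obtain ⟨n, hn, h⟩ := h
  refine ⟨n, hn, fun k hk x hx => ?_⟩
  induction x using QuotientGroup.induction_on with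
  | H x =>
    obtain ⟨y, hy, hxy⟩ := h k hk x ((hmem _ _).1 hx)
    exact ⟨y, (hmem _ _).2 hy, (hmem _ _).2 hxy⟩

/-- A nilpotent group whose upper central sections are virtually divisible is the product of a
divisible subgroup and a subgroup of bounded exponent. -/
theorem exists_isDivisibleSubgroup_mul_hasBoundedExponent (G : Type*) [Group G]
    [Group.IsNilpotent G] (hG : ∀ i, IsVirtuallyDivisibleSection G i) :
    ∃ D F : Subgroup G, IsDivisibleSubgroup D ∧ HasBoundedExponent F ∧
      ∀ g : G, ∃ d ∈ D, ∃ f ∈ F, d * f = g := by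
  revert hG
  refine Group.nilpotent_center_quotient_ind (P := fun G _ _ =>
    (∀ i, IsVirtuallyDivisibleSection G i) → ∃ D F : Subgroup G, IsDivisibleSubgroup D ∧
      HasBoundedExponent F ∧ ∀ g : G, ∃ d ∈ D, ∃ f ∈ F, d * f = g) G ?_ ?_
  · intro G _ _ _
    refine ⟨⊥, ⊥, fun n hn x hx => ⟨1, one_mem _, Subsingleton.elim _ _⟩,
      ⟨1, one_ne_zero, fun x _ => Subsingleton.elim _ _⟩,
      fun g => ⟨1, one_mem _, 1, one_mem _, Subsingleton.elim _ _⟩⟩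
  intro G _ _ ih hG
  obtain ⟨D', F', hD', ⟨m, hm, hF'⟩, hDF'⟩ := ih fun i => (hG (i + 1)).quotient_center
  obtain ⟨n, hn, hZ⟩ := hG 0
  simp only [zero_add, Subgroup.upperCentralSeries_one, Subgroup.upperCentralSeries_zero, mem_bot,
    inv_mul_eq_one] at hZ
  have hcomm : ∀ z ∈ center G, ∀ g, Commute g z := fun z hz => mem_center_iff.1 hz
  have hroot : ∀ k ≠ 0, ∀ h : G, (h : G ⧸ center G) ∈ D' → ∃ y : G, (y : G ⧸ center G) ∈ D' ∧
      (y ^ k)⁻¹ * h ∈ center G := by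
    intro k hk h hh
    obtain ⟨y, hy, hyh⟩ := hD' k hk h hh
    induction y using QuotientGroup.induction_on with
    | H y =>
      rw [← QuotientGroup.mk_pow, QuotientGroup.eq] at hyh
      exact ⟨y, hy, hyh⟩
  have hmk : ∀ z ∈ center G, (z : G ⧸ center G) = 1 := fun z hz =>
    (QuotientGroup.eq_one_iff z).2 hz
  -- Lifting a root from G/Z(G) leaves a central error z. The n-th power turns it into z^n, which
  -- has k-th roots of the form w^n with w central.
  let S : Set G := {x | ∃ h : G, (h : G ⧸ center G) ∈ D' ∧ h ^ n = x}
  -- The power m sends a lift of an element of F' into the centre. Its n-th power is then w^(n m n)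
  -- with w central, so dividing the lift by w^n gives an element of order dividing m n.
  let T : Set G := {x | (x : G ⧸ center G) ∈ F' ∧ x ^ (m * n) = 1}
  have hzS : ∀ z ∈ center G, z ^ n ∈ S := fun z hz => ⟨z, by rw [hmk z hz]; exact one_mem _, rfl⟩
  refine ⟨closure S, closure T, isDivisibleSubgroup_closure ?_,
    hasBoundedExponent_closure (mul_ne_zero hm hn) fun s hs => hs.2, fun g => ?_⟩
  · rintro k hk _ ⟨h, hh, rfl⟩
    obtain ⟨y, hy, hyh⟩ := hroot k hk h hh
    obtain ⟨w, hw, hwz⟩ := hZ k hk _ hyh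
    refine ⟨(y * w) ^ n, subset_closure ⟨y * w, ?_, rfl⟩, ?_⟩
    · rw [QuotientGroup.mk_mul, hmk w hw, mul_one]
      exact hy
    · have hh' : h = y ^ k * ((y ^ k)⁻¹ * h) := (mul_inv_cancel_left _ _).symm
      rw [← pow_mul, (hcomm w hw y).mul_pow, hwz, hh', ((hcomm _ hyh _).mul_pow), ← pow_mul,
        mul_comm k n, mul_inv_cancel_left]
  · obtain ⟨d, hd, f, hf, hdf⟩ := hDF' g
    induction d using QuotientGroup.induction_on with
    | H d =>
    obtain ⟨y, hy, hyd⟩ := hroot n hn d hd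
    have hg : ((y ^ n)⁻¹ * g : G) ∈ F'.comap (QuotientGroup.mk' (center G)) := by
      rw [mem_comap, QuotientGroup.mk'_apply, QuotientGroup.mk_mul, ← hdf, ← mul_assoc,
        ← QuotientGroup.mk_mul, hmk _ hyd, one_mul]
      exact hf
    have hgm : ((y ^ n)⁻¹ * g) ^ m ∈ center G := by
      rw [← QuotientGroup.eq_one_iff, QuotientGroup.mk_pow]
      exact hF' _ hg
    obtain ⟨w, hw, hwz⟩ := hZ (m * n) (mul_ne_zero hm hn) _ hgm
    have hwn : w ^ n ∈ center G := pow_mem hw n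
    refine ⟨y ^ n * w ^ n, mul_mem (subset_closure ⟨y, hy, rfl⟩) (subset_closure (hzS w hw)),
      (w ^ n)⁻¹ * ((y ^ n)⁻¹ * g), subset_closure ⟨?_, ?_⟩, by group⟩
    · rw [QuotientGroup.mk_mul, hmk _ (inv_mem hwn), one_mul]
      exact hg
    · rw [(hcomm _ (inv_mem hwn) _).symm.mul_pow, pow_mul ((y ^ n)⁻¹ * g), ← hwz, inv_pow,
        ← pow_mul, inv_mul_cancel]

end

/-! ### Central products and definability of the factors -/

section

variable {G : Type*} [Group G]

/-- Some N-th power map sends all of G into the centralizer of the elements killed by n, and d is an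
N-th power. -/
theorem commute_of_isDivisibleSubgroup [Group.IsNilpotent G] {D : Subgroup G}
    (hD : IsDivisibleSubgroup D) {n : ℕ} (hn : n ≠ 0) {d b : G} (hd : d ∈ D) (hb : b ^ n = 1) :
    Commute d b := by
  obtain ⟨N, hN, h⟩ := exists_commute_pow_of_isNilpotent G hn
  obtain ⟨e, -, rfl⟩ := hD N hN d hd
  exact h e b hb

/-- In a nilpotent group that is a product of a divisible subgroup and a subgroup of bounded
exponent, the factors can be defined by equations. -/
theorem exists_isCentralProduct [Group.IsNilpotent G] {D F : Subgroup G}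
    (hD : IsDivisibleSubgroup D) (hF : HasBoundedExponent F)
    (hDF : ∀ g : G, ∃ d ∈ D, ∃ f ∈ F, d * f = g) :
    ∃ (N : ℕ) (F' : Subgroup G), N ≠ 0 ∧ (∀ x, x ∈ D ↔ ∃ y, y ^ N = x) ∧
      (∀ x, x ∈ F' ↔ x ^ N = 1) ∧ IsCentralProduct D F' := by
  obtain ⟨N, hN, hF⟩ := hF
  have hcomm : ∀ d ∈ D, ∀ b, b ^ N = 1 → Commute d b := fun d hd b hb =>
    commute_of_isDivisibleSubgroup hD hN hd hb
  have hpow : ∀ d ∈ D, ∀ f ∈ F, (d * f) ^ N = d ^ N := fun d hd f hf => by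
    rw [(hcomm d hd f (hF f hf)).mul_pow, hF f hf, mul_one]
  have hcenter : ∀ d ∈ D, d ^ N = 1 → d ∈ Subgroup.center G := by
    intro d hd hdN
    rw [Subgroup.mem_center_iff]
    intro g
    obtain ⟨d', hd', f, hf, rfl⟩ := hDF g
    exact Commute.mul_left (hcomm d' hd' d hdN) (hcomm d hd f (hF f hf)).symm
  -- The D-parts d and e of x and y satisfy d^N = e^N = 1, and D commutes with F and with e, so (d
  -- f)(e g) = (d e)(f g) has N-th power d^N e^N = 1.
  have hmul : ∀ x y : G, x ^ N = 1 → y ^ N = 1 → (x * y) ^ N = 1 := by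
    intro x y hx hy
    obtain ⟨d, hd, f, hf, rfl⟩ := hDF x
    obtain ⟨e, he, g, hg, rfl⟩ := hDF y
    rw [hpow d hd f hf] at hx
    rw [hpow e he g hg] at hy
    have h1 : d * f * (e * g) = d * e * (f * g) := by
      rw [mul_assoc, ← mul_assoc f, ← (hcomm e he f (hF f hf)).eq, mul_assoc e, ← mul_assoc]
    rw [h1, hpow _ (mul_mem hd he) _ (mul_mem hf hg), (hcomm d hd e hy).mul_pow, hx, hy, one_mul]
  let F' : Subgroup G :=
    { carrier := {x | x ^ N = 1}
      one_mem' := one_pow N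
      mul_mem' := fun {x y} => hmul x y
      inv_mem' := fun {x} (hx : x ^ N = 1) => by
        change x⁻¹ ^ N = 1
        rw [inv_pow, hx, inv_one] }
  have hF' : ∀ x, x ∈ F' ↔ x ^ N = 1 := fun _ => Iff.rfl
  have hDN : ∀ x, x ∈ D ↔ ∃ y, y ^ N = x := by
    refine fun x => ⟨fun hx => ?_, ?_⟩
    · obtain ⟨y, -, hy⟩ := hD N hN x hx
      exact ⟨y, hy⟩
    · rintro ⟨y, rfl⟩
      obtain ⟨d, hd, f, hf, rfl⟩ := hDF y
      rw [hpow d hd f hf]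
      exact pow_mem hd N
  refine ⟨N, F', hN, hDN, hF', ⟨⟨fun x hx g => ?_⟩, ⟨fun x hx g => ?_⟩, fun g => ?_, ?_⟩⟩
  · obtain ⟨y, rfl⟩ := (hDN x).1 hx
    exact (hDN _).2 ⟨g * y * g⁻¹, conj_pow⟩
  · rw [hF'] at hx ⊢
    rw [conj_pow, hx, mul_one, mul_inv_cancel]
  · obtain ⟨d, hd, f, hf, h⟩ := hDF g
    exact ⟨d, hd, f, hF f hf, h⟩
  · exact fun x hx => hcenter x hx.1 hx.2

end

open FirstOrder FirstOrder.Language Set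

variable {L : FirstOrder.Language.{u, v}} {G : Type w} [L.Structure G] [Group G]

-- The section is the centre of G/Z_i. The preimage of its k-th powers is Z_{i+1}^k Z_i, which for
-- every k is definable over the same finite set A.
open scoped IsMulCommutative in
theorem IsSmallStructure.isVirtuallyDivisibleSection (hG : IsSmallStructure L G) {A : Set G}
    (hA : A.Finite) (hmul : A.Definable L {x : Fin 3 → G | x 0 * x 1 = x 2}) (i : ℕ) :
    IsVirtuallyDivisibleSection G i := by
  let Z := Subgroup.upperCentralSeries G i
  let C := Subgroup.upperCentralSeries G (i + 1)
  have hC : C = (Subgroup.center (G ⧸ Z)).comap (QuotientGroup.mk' Z) :=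
    Subgroup.upperCentralSeriesStep_eq_comap_center Z
  have hZC : Z ≤ C := Subgroup.upperCentralSeries_mono G i.le_succ
  let f : C →* Subgroup.center (G ⧸ Z) :=
    ((QuotientGroup.mk' Z).comp C.subtype).codRestrict _ fun x => by
      exact hC.le x.2
  have hfeq : ∀ x y : C, f x = f y ↔ (x : G)⁻¹ * y ∈ Z := by
    intro x y
    rw [← QuotientGroup.eq, Subtype.ext_iff]
    rfl
  have hf : Function.Surjective f := by
    rintro ⟨q, hq⟩
    obtain ⟨x, rfl⟩ := QuotientGroup.mk'_surjective Z q
    exact ⟨⟨x, hC ▸ hq⟩, rfl⟩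
  obtain ⟨n, hn, h⟩ := hG.isVirtuallyDivisible hA hmul f hf fun k => by
    convert definable_pow_mul hmul (definable_upperCentralSeries hmul (i + 1))
      (definable_upperCentralSeries hmul i) k using 1
    ext x
    constructor
    · rintro ⟨x, ⟨q, hq⟩, rfl⟩
      obtain ⟨y, rfl⟩ := hf q
      exact ⟨y, y.2, (hfeq (y ^ k) x).1 ((map_pow f y k).trans hq)⟩
    · rintro ⟨y, hy, hyx⟩
      have hx : x ∈ C := by
        rw [← mul_inv_cancel_left (y ^ k) x]
        exact mul_mem (pow_mem hy k) (hZC hyx)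
      refine ⟨⟨x, hx⟩, ⟨f ⟨y, hy⟩, ?_⟩, rfl⟩
      exact (map_pow f ⟨y, hy⟩ k).symm.trans ((hfeq (⟨y, hy⟩ ^ k) ⟨x, hx⟩).2 hyx)
  refine ⟨n, hn, fun k hk x hx => ?_⟩
  obtain ⟨r, hr⟩ := h k hk (f ⟨x, hx⟩)
  obtain ⟨y, rfl⟩ := hf r
  rw [← map_pow, ← map_pow] at hr
  exact ⟨y, y.2, (hfeq _ _).1 hr⟩

end SmallGroups

open SmallGroups in
theorem mainTheorem3 (L : FirstOrder.Language.{u, v}) (G : Type w) [L.Structure G] [Group G]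
    (hmul : SmallGroups.HasDefinableMul L G) (hsmall : SmallGroups.IsSmallStructure L G)
    (hnil : Group.IsNilpotent G) :
    ∃ D F : Subgroup G,
      SmallGroups.IsDefinableSubgroup L D ∧ SmallGroups.IsDivisibleSubgroup D ∧
      SmallGroups.IsDefinableSubgroup L F ∧ SmallGroups.HasBoundedExponent F ∧
      SmallGroups.IsCentralProduct D F := by
  -- One formula uses finitely many parameters, as the type count requires.
  obtain ⟨A, -, hA⟩ := Set.definable_iff_finitely_definable.1 hmul
  obtain ⟨D, F, hD, hF, hDF⟩ := exists_isDivisibleSubgroup_mul_hasBoundedExponent G fun i =>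
    hsmall.isVirtuallyDivisibleSection A.finite_toSet hA i
  obtain ⟨N, F', hN, hDN, hFN, h⟩ := exists_isCentralProduct hD hF hDF
  refine ⟨D, F', ?_, hD, ?_, ⟨N, hN, fun x hx => (hFN x).1 hx⟩, h⟩
  · have hset : (D : Set G) = {x | ∃ y, y ^ N = x} := Set.ext hDN
    rw [IsDefinableSubgroup, hset]
    exact definable_exists (R := fun v y => y ^ N = v 0)
      (((definableMap_proj (Sum.inr 0)).pow hmul N).definable_eq (definableMap_proj (Sum.inl 0)))
  · have hset : (F' : Set G) = {x | x ^ N = 1} := Set.ext hFN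
    rw [IsDefinableSubgroup, hset]
    exact ((definableMap_proj (0 : Fin 1)).pow hmul N).definable_eq (DefinableMap.one hmul)
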